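/- Let $N\in\{3,4,6,7,8,9,12,16,18\}$. Call a subgroup $H\subset(\mathbb Z/N\mathbb Z)^\times$ of index two \emph{admissible} if its cosets are $H$ and $-H$, i.e. if $-1\notin H$. Then admissible subgroups exist and every admissible subgroup is cyclic. Fix an admissible $H$. A (non-cuspidal) rational point $(E,C)$ of $\mathcal X_0(N)$ is a pair of an elliptic curve $E/\mathbb Q$ and a cyclic subgroup $C\subset E(\overline{\mathbb Q})$ of order $N$ that is stable under $G_{\mathbb Q}=\mathrm{Gal}(\overline{\mathbb Q}/\mathbb Q)$. A (non-cuspidal) rational point of $\mathcal X_{1/2}(N)=\mathcal X_1(N)/H$ is a pair of an elliptic curve $E/\mathbb Q$ and a $G_{\mathbb Q}$-stable set of the form $HP=\{hP: h\in H\}$, where $P\in E(\overline{\mathbb Q})$ has exact order $N$. For an integer $d\neq 0$ let $E_d$ be the quadratic twist of $E$ by $d$ (if $E:y^2=x^3+Ax+B$, then $E_d: dy^2=x^3+Ax+B$), and let $\phi_d:E\to E_d$ be the isomorphism over $\mathbb Q(\sqrt d)$. Let $(E,C)$ be a non-cuspidal rational point of $\mathcal X_0(N)$, and let $\chi:G_{\mathbb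 Q}\to(\mathbb Z/N\mathbb Z)^\times$ be the character with $\sigma P=\chi(\sigma)P$ for all $P\in C$. Then there is a squarefree integer $d$ such that: 1. $\chi=\chi_1\chi_2$ for homomorphisms $\chi_1:G_{\mathbb Q}\to\{\pm1\}$ and $\chi_2:G_{\mathbb Q}\to H$, where $\sigma(\sqrt d)=\chi_1(\sigma)\sqrt d$ for all $\sigma\in G_{\mathbb Q}$; the subgroup $\phi_d(C)\subset E_d(\overline{\mathbb Q})$ is $G_{\mathbb Q}$-stable and cyclic of order $N$, and $G_{\mathbb Q}$ acts on it through $\chi_2$. 2. There is a generator $P$ of $\phi_d(C)$ such that the subset $H_C=HP$ of the generators of $\phi_d(C)$ is $G_{\mathbb Q}$-stable; and $(E_d,H_C)$ and $(E_d,-H_C)$ are rational points of $\mathcal X_{1/2}(N)$. Moreover $d$ is unique: if $d'$ is a squarefree integer and $\phi_{d'}(C)$ has a generator $P$ for which $HP$ is $G_{\mathbb Q}$-stable, then $d'=d$. -/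

import Mathlib

open scoped Pointwise

noncomputable section

namespace HalfModular

/-- An algebraic closure of the rationals. -/
abbrev Qbar : Type := AlgebraicClosure ℚ

instance instDecidableEqQbar : DecidableEq Qbar := Classical.decEq _

/-- The absolute Galois group of the rationals. -/
abbrev GQ : Type := Qbar ≃ₐ[ℚ] Qbar

/-- The group of geometric points of a Weierstrass curve over the rationals. -/
abbrev GeomPoint (E : WeierstrassCurve ℚ) : Type :=
  (WeierstrassCurve.Affine.baseChange E Qbar).Point

/-- The Galois action on geometric points: a Galois element is applied to the coordinates. -/
def gal (E : WeierstrassCurve ℚ) (σ : GQ) : GeomPoint E →+ GeomPoint E :=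
  WeierstrassCurve.Affine.Point.map (W' := E) (σ : Qbar →ₐ[ℚ] Qbar)

/-- A set of geometric points is defined over the rationals if it is Galois stable. -/
def IsDefinedOverQ (E : WeierstrassCurve ℚ) (S : Set (GeomPoint E)) : Prop :=
  ∀ σ : GQ, ∀ P ∈ S, gal E σ P ∈ S

/-- Multiplication by a unit modulo `N` on the points; it is used on points killed by `N` only. -/
def unitMul {A : Type*} [AddCommGroup A] {N : ℕ} (a : (ZMod N)ˣ) (P : A) : A :=
  (a : ZMod N).val • P

/-- The set `{h P : h ∈ H}`. -/
def orbit {A : Type*} [AddCommGroup A] {N : ℕ} (H : Subgroup (ZMod N)ˣ) (P : A) : Set A :=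
  {Q | ∃ h ∈ H, Q = unitMul h P}

/-- The rational points of `Y_0(N)`: pairs of an elliptic curve over the rationals and a
rational cyclic subgroup of order `N`. -/
def YZero (N : ℕ) : Set (Σ E : WeierstrassCurve ℚ, AddSubgroup (GeomPoint E)) :=
  {x | x.1.IsElliptic ∧ IsAddCyclic x.2 ∧ Nat.card x.2 = N ∧ IsDefinedOverQ x.1 x.2}

/-- The rational points of `Y_{1/2}(N) = Y_1(N) / H`, the fibrewise quotient: pairs of an elliptic
curve `E` over the rationals and an `H`-orbit of points of exact order `N` of `E`, the orbit (not
necessarily its points) being defined over the rationals. -/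
def YHalf (N : ℕ) (H : Subgroup (ZMod N)ˣ) :
    Set (Σ E : WeierstrassCurve ℚ, Set (GeomPoint E)) :=
  {x | x.1.IsElliptic ∧ (∃ P : GeomPoint x.1, addOrderOf P = N ∧ x.2 = orbit H P) ∧
    IsDefinedOverQ x.1 x.2}

/-- `S` is the index two subgroup `H` of the set of generators of the cyclic group `C`, where
the choice of a generator identifies the set of generators with the units modulo `N`. -/
def IsHalfOfGenerators {A : Type*} [AddCommGroup A] {N : ℕ} (H : Subgroup (ZMod N)ˣ)
    (C : AddSubgroup A) (S : Set A) : Prop :=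
  ∃ P : A, AddSubgroup.zmultiples P = C ∧ S = orbit H P

/-- Subgroups of index two whose cosets are `H` and `-H`. -/
def IsAdmissible {N : ℕ} (H : Subgroup (ZMod N)ˣ) : Prop :=
  H.index = 2 ∧ (-1 : (ZMod N)ˣ) ∉ H

/-! ### Quadratic twists -/

/-- The quadratic twist by `d`. The curve `E` is `Y² = x³ + (b₂/4) x² + (b₄/2) x + b₆/4` with
`Y = y + (a₁ x + a₃)/2`, and the twist is `d Y² = x³ + (b₂/4) x² + (b₄/2) x + b₆/4`, written
in Weierstrass form in the coordinates `(d x, d² Y)`. For `Y² = x³ + A x + B` this gives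
`Y² = x³ + d² A x + d³ B`. -/
def twist (E : WeierstrassCurve ℚ) (d : ℤ) : WeierstrassCurve ℚ where
  a₁ := 0
  a₂ := d * E.b₂ / 4
  a₃ := 0
  a₄ := d ^ 2 * E.b₄ / 2
  a₆ := d ^ 3 * E.b₆ / 4

/-- A square root of the integer `d`. -/
def root (d : ℤ) : Qbar :=
  (IsAlgClosed.exists_pow_nat_eq (d : Qbar) (n := 2) two_pos).choose

theorem root_sq (d : ℤ) : root d ^ 2 = d :=
  (IsAlgClosed.exists_pow_nat_eq (d : Qbar) (n := 2) two_pos).choose_spec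

theorem root_ne_zero {d : ℤ} (hd : d ≠ 0) : root d ≠ 0 := by
  intro h
  have := root_sq d
  rw [h] at this
  apply hd
  have h2 : (d : Qbar) = 0 := by rw [← this]; norm_num
  exact_mod_cast h2

open WeierstrassCurve.Affine in
/-- The map `(x, y) ↦ (s² x, s³ (y + (a₁ x + a₃)/2))` between Weierstrass curves whose coefficients
are related accordingly. -/
def scaleHom {F : Type*} [Field F] [DecidableEq F] (W W' : WeierstrassCurve.Affine F)
    (h2 : (2 : F) ≠ 0) (s : F) (hs : s ≠ 0)
    (h₁ : W'.a₁ = 0) (h₃ : W'.a₃ = 0)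
    (e₂ : W'.a₂ = s ^ 2 * (W.a₂ + W.a₁ ^ 2 / 4))
    (e₄ : W'.a₄ = s ^ 4 * (W.a₄ + W.a₁ * W.a₃ / 2))
    (e₆ : W'.a₆ = s ^ 6 * (W.a₆ + W.a₃ ^ 2 / 4)) :
    W.Point →+ W'.Point :=
  have h4 : (4 : F) ≠ 0 := by
    have : (4 : F) = 2 * 2 := by norm_num
    rw [this]; exact mul_ne_zero h2 h2
  have ns : ∀ {x y : F}, W.Nonsingular x y →
      W'.Nonsingular (s ^ 2 * x) (s ^ 3 * (y + (W.a₁ * x + W.a₃) / 2)) := by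
    intro x y h
    rw [nonsingular_iff', equation_iff'] at h ⊢
    obtain ⟨he, hn⟩ := h
    have key : 2 * (s ^ 3 * (y + (W.a₁ * x + W.a₃) / 2)) + W'.a₁ * (s ^ 2 * x) + W'.a₃
        = s ^ 3 * (2 * y + W.a₁ * x + W.a₃) := by
      rw [h₁, h₃]; field_simp; ring
    refine ⟨?_, ?_⟩
    · rw [h₁, h₃, e₂, e₄, e₆]
      have := congrArg (fun z => s ^ 6 * z) he
      simp only [mul_zero] at this
      refine Eq.trans ?_ this
      field_simp
      ring
    · rw [key]
      by_cases hy : 2 * y + W.a₁ * x + W.a₃ = 0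
      · left
        have hx := hn.resolve_right (fun h => h hy)
        intro hc
        apply hx
        rw [h₁, e₂, e₄] at hc
        have hy' : W.a₁ * (2 * y + W.a₁ * x + W.a₃) = 0 := by rw [hy, mul_zero]
        have hc' : s ^ 4 * (2 * (W.a₁ * y - (3 * x ^ 2 + 2 * W.a₂ * x + W.a₄))) = 0 := by
          have := congrArg (fun z => 2 * z) hc
          simp only [mul_zero] at this
          refine Eq.trans ?_ this
          have h5 : 2 * (W.a₁ * y) = - W.a₁ * (W.a₁ * x + W.a₃) := by linear_combination hy'
          have h6 : 2 * (W.a₁ * y - (3 * x ^ 2 + 2 * W.a₂ * x + W.a₄))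
            = - W.a₁ * (W.a₁ * x + W.a₃) - 2 * (3 * x ^ 2 + 2 * W.a₂ * x + W.a₄) := by
            linear_combination h5
          rw [h6]
          field_simp
          ring
        exact ((mul_eq_zero.mp ((mul_eq_zero.mp hc').resolve_left (pow_ne_zero _ hs))).resolve_left
          h2)
      · right
        exact mul_ne_zero (pow_ne_zero _ hs) hy
  { toFun := fun P => match P with
      | .zero => .zero
      | .some x y h => .some (s ^ 2 * x) (s ^ 3 * (y + (W.a₁ * x + W.a₃) / 2)) (ns h)
    map_zero' := rfl
    map_add' := by
      rintro (_ | ⟨x₁, y₁, k₁⟩) (_ | ⟨x₂, y₂, k₂⟩)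
      any_goals rfl
      have hneg : ∀ x y : F, W'.negY (s ^ 2 * x) (s ^ 3 * (y + (W.a₁ * x + W.a₃) / 2)) =
          s ^ 3 * (W.negY x y + (W.a₁ * x + W.a₃) / 2) := by
        intro x y
        simp only [negY, h₁, h₃]
        field_simp
        ring
      have hX : ∀ a b : F, s ^ 2 * a = s ^ 2 * b ↔ a = b :=
        fun a b => mul_right_inj' (pow_ne_zero _ hs)
      have hcond : (s ^ 2 * x₁ = s ^ 2 * x₂ ∧ s ^ 3 * (y₁ + (W.a₁ * x₁ + W.a₃) / 2) =
          W'.negY (s ^ 2 * x₂) (s ^ 3 * (y₂ + (W.a₁ * x₂ + W.a₃) / 2))) ↔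
          (x₁ = x₂ ∧ y₁ = W.negY x₂ y₂) := by
        rw [hneg, hX, mul_right_inj' (pow_ne_zero _ hs)]
        constructor
        · rintro ⟨rfl, h⟩; exact ⟨rfl, by simpa using h⟩
        · rintro ⟨rfl, h⟩; exact ⟨rfl, by rw [h]⟩
      by_cases hxy : x₁ = x₂ ∧ y₁ = W.negY x₂ y₂
      · rw [Point.add_of_Y_eq hxy.1 hxy.2]
        exact (Point.add_of_Y_eq (hcond.mpr hxy).1 (hcond.mpr hxy).2).symm
      · have hxy' := fun h => hxy (hcond.mp h)
        rw [Point.add_some hxy]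
        refine Eq.trans ?_ (Point.add_some hxy').symm
        have hsl : W'.slope (s ^ 2 * x₁) (s ^ 2 * x₂) (s ^ 3 * (y₁ + (W.a₁ * x₁ + W.a₃) / 2))
            (s ^ 3 * (y₂ + (W.a₁ * x₂ + W.a₃) / 2)) = s * (W.slope x₁ x₂ y₁ y₂ + W.a₁ / 2) := by
          by_cases hx : x₁ = x₂
          · have hy : y₁ ≠ W.negY x₂ y₂ := fun h => hxy ⟨hx, h⟩
            have hy' := fun h => hxy' ⟨(hX _ _).mpr hx, h⟩
            rw [slope_of_Y_ne hx hy, slope_of_Y_ne ((hX _ _).mpr hx) hy', hneg]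
            have hyy : y₁ = y₂ := Y_eq_of_Y_ne k₁.1 k₂.1 hx hy
            have hD : y₁ - W.negY x₁ y₁ ≠ 0 := by
              subst hx; subst hyy; exact sub_ne_zero.mpr hy
            have hD' : s ^ 3 * (y₁ + (W.a₁ * x₁ + W.a₃) / 2) -
                s ^ 3 * (W.negY x₁ y₁ + (W.a₁ * x₁ + W.a₃) / 2) = s ^ 3 * (y₁ - W.negY x₁ y₁) := by
              ring
            have hDe : y₁ - W.negY x₁ y₁ = 2 * y₁ + W.a₁ * x₁ + W.a₃ := by
              simp only [negY]; ring
            rw [hD', h₁, e₂, e₄]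
            rw [hDe] at hD ⊢
            rw [div_eq_iff (mul_ne_zero (pow_ne_zero _ hs) hD)]
            have hR : ∀ B D : F, D ≠ 0 →
                s * (B / D + W.a₁ / 2) * (s ^ 3 * D) = s ^ 4 * (B + W.a₁ / 2 * D) := by
              intro B D hD
              field_simp
            rw [hR _ _ hD]
            field_simp
            ring
          · have hx' := fun h => hx ((hX _ _).mp h)
            rw [slope_of_X_ne hx, slope_of_X_ne hx']
            have h12 : x₁ - x₂ ≠ 0 := sub_ne_zero.mpr hx
            have h12' : s ^ 2 * x₁ - s ^ 2 * x₂ = s ^ 2 * (x₁ - x₂) := by ring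
            rw [h12']
            field_simp
            ring
        have hadd : W'.addX (s ^ 2 * x₁) (s ^ 2 * x₂) (s * (W.slope x₁ x₂ y₁ y₂ + W.a₁ / 2)) =
            s ^ 2 * W.addX x₁ x₂ (W.slope x₁ x₂ y₁ y₂) := by
          simp only [addX, h₁, e₂]
          field_simp
          ring
        refine (Point.some.injEq ..).mpr ⟨?_, ?_⟩
        · rw [hsl, hadd]
        · simp only [addY]
          rw [hsl, hadd, ← hneg]
          congr 1
          simp only [negAddY, hadd]
          field_simp
          ring }

/-- The isomorphism `φ(x, y) = (d x, d √d (y + (a₁ x + a₃)/2))` from `E` to its twist, on geometric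
points. -/
def twistIso (E : WeierstrassCurve ℚ) {d : ℤ} (hd : d ≠ 0) :
    GeomPoint E →+ GeomPoint (twist E d) :=
  scaleHom _ _ two_ne_zero (root d) (root_ne_zero hd)
    (by simp [twist, WeierstrassCurve.Affine.baseChange])
    (by simp [twist, WeierstrassCurve.Affine.baseChange])
    (by
      rw [root_sq]
      simp [twist, WeierstrassCurve.b₂]
      ring)
    (by
      rw [show root d ^ 4 = (root d ^ 2) ^ 2 by ring, root_sq]
      simp [twist, WeierstrassCurve.b₄]
      ring)
    (by
      rw [show root d ^ 6 = (root d ^ 2) ^ 3 by ring, root_sq]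
      simp [twist, WeierstrassCurve.b₆]
      ring)

/-- The image `φ(C)` of a subgroup `C` in the twist. -/
def twistSubgroup (E : WeierstrassCurve ℚ) {d : ℤ} (hd : d ≠ 0) (C : AddSubgroup (GeomPoint E)) :
    AddSubgroup (GeomPoint (twist E d)) :=
  C.map (twistIso E hd)

/-- The group homomorphism from the signs to the units modulo `N`. -/
def signToUnits (N : ℕ) : ℤˣ →* (ZMod N)ˣ :=
  Units.map (Int.castRingHom (ZMod N) : ℤ →* ZMod N)

end HalfModular

end

/-!
The units modulo `N` are the direct product of `{±1}` and an admissible subgroup `H`: for each of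
the nine values of `N` there is a unit `u` with `(ℤ/N)ˣ = {±1} × ⟨u⟩`
(`exists_isCompl_neg_one`), so `⟨u⟩` is admissible, and any admissible `H` contains `u` or `-u` and
is generated by it (`IsAdmissible.isCyclic`).

The Galois group acts on the cyclic group `C` through a character `χ` (`exists_character`), and the
projection of `χ` to `{±1}` is a quadratic character `χ₁`. Its kernel is open, because it contains
the stabilizer of a generator of `C`; hence `χ₁` is the character of `√d` for a squarefree `d`
(`exists_squarefree_of_isOpen_ker`). Since the isomorphism `φ` onto the twist by `d` satisfies
`σ (φ P) = χ₁(σ) φ (σ P)` (`gal_twistIso`), the Galois group acts on `φ(C)` through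
`χ₁ χ = χ₂`, which takes values in `H`, and the `H`-orbit of a generator is stable.

Conversely, if an `H`-orbit of generators is stable in the twist by `d'`, then the character `ψ` of
`√d'` has `ψ χ` with values in `H` (`sign_mul_mem_of_isDefinedOverQ`), so `ψ = χ₁` because
`-1 ∉ H`. Then `√d √d'` is rational, and two squarefree integers whose product is a square are equal
(`eq_of_root_galois`).
-/

namespace HalfModular

/-! ### Admissible subgroups -/

lemma neg_one_notMem_zpowers_and_mem_or_neg_mem {n : ℕ} {u : (ZMod n)ˣ} {m : ℕ} (hm : 0 < m)
    (hu : u ^ m = 1) (h1 : ∀ k < m, u ^ k ≠ -1)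
    (h2 : ∀ v : (ZMod n)ˣ, ∃ k < m, v = u ^ k ∨ -v = u ^ k) :
    -1 ∉ Subgroup.zpowers u ∧
      ∀ v : (ZMod n)ˣ, v ∈ Subgroup.zpowers u ∨ -v ∈ Subgroup.zpowers u := by
  refine ⟨?_, fun v => ?_⟩
  · rintro ⟨k, hk⟩
    obtain ⟨j, hj⟩ := Int.eq_ofNat_of_zero_le (Int.emod_nonneg k (b := m) (by omega))
    refine h1 j (by have := Int.emod_lt_of_pos k (b := m) (by omega); omega) ?_
    rw [← hk]
    simp only
    rw [← Int.emod_add_mul_ediv k m, hj, zpow_add, zpow_mul]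
    simp [hu]
  · obtain ⟨k, -, h | h⟩ := h2 v
    · exact Or.inl (h ▸ Subgroup.npow_mem_zpowers u k)
    · exact Or.inr (h ▸ Subgroup.npow_mem_zpowers u k)

/-- For these `N`, the subgroup `{±1}` of the units modulo `N` has a cyclic complement. -/
lemma exists_isCompl_neg_one {N : ℕ} (hN : N ∈ ({3, 4, 6, 7, 8, 9, 12, 16, 18} : Finset ℕ)) :
    ∃ u : (ZMod N)ˣ, -1 ∉ Subgroup.zpowers u ∧
      ∀ v : (ZMod N)ˣ, v ∈ Subgroup.zpowers u ∨ -v ∈ Subgroup.zpowers u := by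
  fin_cases hN
  · exact ⟨(1 : (ZMod 3)ˣ),
      neg_one_notMem_zpowers_and_mem_or_neg_mem (m := 1) (by decide) (by decide) (by decide)
        (by decide)⟩
  · exact ⟨(1 : (ZMod 4)ˣ),
      neg_one_notMem_zpowers_and_mem_or_neg_mem (m := 1) (by decide) (by decide) (by decide)
        (by decide)⟩
  · exact ⟨(1 : (ZMod 6)ˣ),
      neg_one_notMem_zpowers_and_mem_or_neg_mem (m := 1) (by decide) (by decide) (by decide)
        (by decide)⟩
  · exact ⟨(⟨2, 4, by decide, by decide⟩ : (ZMod 7)ˣ),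
      neg_one_notMem_zpowers_and_mem_or_neg_mem (m := 3) (by decide) (by decide) (by decide)
        (by decide)⟩
  · exact ⟨(⟨3, 3, by decide, by decide⟩ : (ZMod 8)ˣ),
      neg_one_notMem_zpowers_and_mem_or_neg_mem (m := 2) (by decide) (by decide) (by decide)
        (by decide)⟩
  · exact ⟨(⟨4, 7, by decide, by decide⟩ : (ZMod 9)ˣ),
      neg_one_notMem_zpowers_and_mem_or_neg_mem (m := 3) (by decide) (by decide) (by decide)
        (by decide)⟩
  · exact ⟨(⟨5, 5, by decide, by decide⟩ : (ZMod 12)ˣ),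
      neg_one_notMem_zpowers_and_mem_or_neg_mem (m := 2) (by decide) (by decide) (by decide)
        (by decide)⟩
  · exact ⟨(⟨3, 11, by decide, by decide⟩ : (ZMod 16)ˣ),
      neg_one_notMem_zpowers_and_mem_or_neg_mem (m := 4) (by decide) (by decide) (by decide)
        (by decide)⟩
  · exact ⟨(⟨7, 13, by decide, by decide⟩ : (ZMod 18)ˣ),
      neg_one_notMem_zpowers_and_mem_or_neg_mem (m := 3) (by decide) (by decide) (by decide)
        (by decide)⟩

lemma isAdmissible_iff {N : ℕ} {H : Subgroup (ZMod N)ˣ} :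
    IsAdmissible H ↔ (-1 : (ZMod N)ˣ) ∉ H ∧ ∀ v : (ZMod N)ˣ, v ∈ H ∨ -v ∈ H := by
  refine ⟨fun ⟨h2, h1⟩ => ⟨h1, fun v => ?_⟩, fun ⟨h1, hv⟩ => ⟨?_, h1⟩⟩
  · have := Subgroup.mul_mem_iff_of_index_two h2 (a := -1) (b := v)
    rw [neg_one_mul] at this
    tauto
  · exact Subgroup.index_eq_two_iff_exists_notMem_and.mpr
      ⟨-1, h1, fun b => by rw [mul_neg_one]; exact (hv b).symm⟩

lemma IsAdmissible.isCyclic {N : ℕ} {H : Subgroup (ZMod N)ˣ} (hH : IsAdmissible H)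
    {u : (ZMod N)ˣ}
    (hu : ∀ v : (ZMod N)ˣ, v ∈ Subgroup.zpowers u ∨ -v ∈ Subgroup.zpowers u) : IsCyclic H := by
  obtain ⟨h1, hv⟩ := isAdmissible_iff.mp hH
  -- if `-v` were a power of `w` for some `v` in `H`, then `-1` would lie in `H`
  have gen : ∀ w ∈ H, (∀ v : (ZMod N)ˣ, v ∈ Subgroup.zpowers w ∨ -v ∈ Subgroup.zpowers w) →
      IsCyclic H := by
    intro w hw hz
    have hle : Subgroup.zpowers w ≤ H := by simpa using hw
    have : H = Subgroup.zpowers w := by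
      refine le_antisymm (fun v hvH => (hz v).resolve_right fun hn => h1 ?_) hle
      have := H.mul_mem (hle hn) (H.inv_mem hvH)
      simpa using this
    rw [this]
    infer_instance
  rcases hv u with h | h
  · exact gen u h hu
  · refine gen (-u) h fun v => ?_
    have key : ∀ x ∈ Subgroup.zpowers u,
        x ∈ Subgroup.zpowers (-u) ∨ -x ∈ Subgroup.zpowers (-u) := by
      rintro _ ⟨k, rfl⟩
      rcases Int.even_or_odd k with hk | hk
      · exact Or.inl ⟨k, hk.neg_zpow u⟩
      · exact Or.inr ⟨k, hk.neg_zpow u⟩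
    rcases hu v with h | h
    · exact key v h
    · simpa [or_comm] using key (-v) h

@[simp] lemma signToUnits_neg_one (N : ℕ) : signToUnits N (-1) = -1 := by
  ext; simp [signToUnits]

lemma signToUnits_mul_self (N : ℕ) (ε : ℤˣ) : signToUnits N ε * signToUnits N ε = 1 := by
  rw [← map_mul, Int.units_mul_self, map_one]

lemma IsAdmissible.eq_one_of_signToUnits_mem {N : ℕ} {H : Subgroup (ZMod N)ˣ}
    (hH : IsAdmissible H) {ε : ℤˣ} (h : signToUnits N ε ∈ H) : ε = 1 := by
  rcases Int.units_eq_one_or ε with rfl | rfl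
  · rfl
  · exact absurd (by simpa using h) hH.2

lemma IsAdmissible.sign_unique {N : ℕ} {H : Subgroup (ZMod N)ˣ} (hH : IsAdmissible H)
    {u : (ZMod N)ˣ} {ε δ : ℤˣ} (hε : signToUnits N ε * u ∈ H) (hδ : signToUnits N δ * u ∈ H) :
    ε = δ := by
  have : signToUnits N (ε * δ⁻¹) ∈ H := by
    have := H.mul_mem hε (H.inv_mem hδ)
    rwa [mul_inv_rev, mul_comm u⁻¹, mul_mul_mul_comm, mul_inv_cancel, mul_one,
      ← map_inv, ← map_mul] at this
  exact mul_inv_eq_one.mp (hH.eq_one_of_signToUnits_mem this)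

/-- The units modulo `N` are the direct product of `±1` and an admissible subgroup; this is the
projection to `±1`. -/
lemma IsAdmissible.exists_sign {N : ℕ} {H : Subgroup (ZMod N)ˣ} (hH : IsAdmissible H) :
    ∃ s : (ZMod N)ˣ →* ℤˣ, ∀ u, signToUnits N (s u) * u ∈ H := by
  have hex : ∀ u : (ZMod N)ˣ, ∃ ε : ℤˣ, signToUnits N ε * u ∈ H := fun u => by
    rcases (isAdmissible_iff.mp hH).2 u with h | h
    · exact ⟨1, by simpa using h⟩
    · exact ⟨-1, by simpa using h⟩
  choose s hs using hex
  refine ⟨MonoidHom.mk' s fun u v => hH.sign_unique (hs _) ?_, hs⟩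
  rw [map_mul, mul_mul_mul_comm]
  exact H.mul_mem (hs u) (hs v)

/-! ### Units modulo `N` acting on torsion points -/

section unitMul

variable {A B : Type*} [AddCommGroup A] [AddCommGroup B] {N : ℕ}

lemma zsmul_eq_zsmul_of_intCast_eq {P : A} (hP : N • P = 0) {k l : ℤ}
    (h : (k : ZMod N) = l) : k • P = l • P := by
  rw [ZMod.intCast_eq_intCast_iff_dvd_sub] at h
  obtain ⟨m, hm⟩ := h
  rw [← sub_eq_zero, ← neg_eq_zero, neg_sub, ← sub_smul, hm, mul_comm, mul_smul,
    natCast_zsmul, hP, smul_zero]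

/-- On points killed by `N`, a unit modulo `N` acts as any integer representing it. -/
lemma unitMul_eq_zsmul [NeZero N] {P : A} (hP : N • P = 0) {a : (ZMod N)ˣ} {k : ℤ}
    (h : (k : ZMod N) = a) : unitMul a P = k • P := by
  rw [unitMul, ← natCast_zsmul]
  exact zsmul_eq_zsmul_of_intCast_eq hP (by simp [h])

lemma unitMul_mul [NeZero N] {P : A} (hP : N • P = 0) (a b : (ZMod N)ˣ) :
    unitMul (a * b) P = unitMul a (unitMul b P) := by
  rw [unitMul_eq_zsmul hP (k := ((a : ZMod N).val * (b : ZMod N).val : ℕ)) (by simp)]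
  simp only [unitMul, natCast_zsmul, mul_smul]

lemma unitMul_signToUnits [NeZero N] {P : A} (hP : N • P = 0) (ε : ℤˣ) :
    unitMul (signToUnits N ε) P = (ε : ℤ) • P :=
  unitMul_eq_zsmul hP (by simp [signToUnits])

lemma map_unitMul (f : A →+ B) (a : (ZMod N)ˣ) (P : A) :
    f (unitMul a P) = unitMul a (f P) :=
  map_nsmul f _ _

lemma unitMul_injective [NeZero N] {P : A} (hP : addOrderOf P = N) {a b : (ZMod N)ˣ}
    (h : unitMul a P = unitMul b P) : a = b := by
  rw [unitMul, unitMul, nsmul_eq_nsmul_iff_modEq, hP, ← ZMod.natCast_eq_natCast_iff] at h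
  ext
  simpa using h

lemma neg_orbit (H : Subgroup (ZMod N)ˣ) (P : A) : -orbit H P = orbit H (-P) := by
  ext Q
  simp only [orbit, unitMul, Set.mem_neg, Set.mem_ofPred_eq, smul_neg, neg_eq_iff_eq_neg]

/-- A group acting on a cyclic group of order `N` acts through a character with values in the units
modulo `N`. -/
lemma exists_character {G : Type*} [Group G] [NeZero N] (ρ : G →* AddMonoid.End A) {P : A}
    (hP : addOrderOf P = N) (hρ : ∀ g, ρ g P ∈ AddSubgroup.zmultiples P) :
    ∃ χ : G →* (ZMod N)ˣ, ∀ g, ∀ Q ∈ AddSubgroup.zmultiples P, ρ g Q = unitMul (χ g) Q := by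
  have hNP : N • P = 0 := hP ▸ addOrderOf_nsmul_eq_zero P
  choose c hc using hρ
  replace hc : ∀ g, c g • P = ρ g P := hc
  have hinj : ∀ {k l : ℤ}, k • P = l • P → (k : ZMod N) = l := by
    intro k l h
    rw [ZMod.intCast_eq_intCast_iff_dvd_sub, ← hP, addOrderOf_dvd_iff_zsmul_eq_zero, sub_smul, h,
      sub_self]
  let f : G →* ZMod N :=
    { toFun := fun g => (c g : ZMod N)
      map_one' := by
        rw [← Int.cast_one]
        exact hinj (by rw [hc, map_one, one_smul]; rfl)
      map_mul' := fun g h => by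
        rw [← Int.cast_mul]
        refine hinj ?_
        rw [hc, map_mul, show (ρ g * ρ h) P = ρ g (ρ h P) from rfl, ← hc h, map_zsmul,
          ← hc g, smul_smul, mul_comm] }
  refine ⟨f.toHomUnits, fun g Q hQ => ?_⟩
  obtain ⟨k, rfl⟩ := hQ
  have : ρ g P = unitMul (f.toHomUnits g) P := by
    rw [unitMul_eq_zsmul hNP (k := c g) (by simp [f]), hc]
  simp only [map_zsmul, this]
  rw [unitMul, unitMul, smul_comm]

end unitMul

/-! ### Quadratic characters of the Galois group -/

/- Instance search finds the rational algebra structure of a division ring of characteristic zero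
on `Qbar`, and not the one of an algebraic closure, to which Mathlib attaches this instance. -/
instance isAlgebraicQbar : Algebra.IsAlgebraic ℚ Qbar := AlgebraicClosure.isAlgebraic ℚ

instance isGaloisQbar : IsGalois ℚ Qbar :=
  have : IsAlgClosure ℚ Qbar := ⟨inferInstance, inferInstance⟩
  have := IsAlgClosure.normal ℚ Qbar
  ⟨⟩

lemma eq_of_squarefree_of_isSquare_mul {d e : ℤ} (hd : Squarefree d) (he : Squarefree e)
    (h : IsSquare (d * e)) : d = e := by
  obtain ⟨m, hm⟩ := h
  have hdm : d ∣ m := (hd.dvd_pow_iff_dvd two_ne_zero).mp ⟨e, by rw [hm, sq]⟩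
  obtain ⟨k, rfl⟩ := hdm
  have hek : e = d * (k * k) := mul_left_cancel₀ hd.ne_zero (by rw [hm]; ring)
  have hk : IsUnit k := he k ⟨d, by rw [hek]; ring⟩
  have : k * k = 1 := by
    rcases Int.isUnit_iff.mp hk with rfl | rfl <;> rfl
  rw [hek, this, mul_one]

lemma exists_squarefree_mul_sq {q : ℚ} (hq : q ≠ 0) :
    ∃ d : ℤ, Squarefree d ∧ ∃ r : ℚ, r ≠ 0 ∧ q = r ^ 2 * d := by
  obtain ⟨a, b, hab, ha⟩ := Nat.sq_mul_squarefree (q.num * q.den).natAbs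
  have hn : q.num * q.den ≠ 0 := mul_ne_zero (Rat.num_ne_zero.mpr hq) (by exact_mod_cast q.den_nz)
  have hden : (q.den : ℚ) ≠ 0 := by exact_mod_cast q.den_nz
  have hb : b ≠ 0 := by
    rintro rfl
    exact hn (Int.natAbs_eq_zero.mp (by rw [← hab]; simp))
  refine ⟨Int.sign (q.num * q.den) * a, ?_, b / q.den, by positivity, ?_⟩
  · rw [← Int.squarefree_natAbs, Int.natAbs_mul, Int.natAbs_sign_of_ne_zero hn, one_mul]
    exact ha
  · have h1 : (q.num * q.den : ℤ) = Int.sign (q.num * q.den) * (b ^ 2 * a : ℕ) := by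
      rw [hab, Int.sign_mul_natAbs]
    have h2 : (q.num * q.den : ℚ) = (Int.sign (q.num * q.den) : ℤ) * (b ^ 2 * a) := by
      exact_mod_cast h1
    have h3 : q * q.den = q.num := Rat.mul_den_eq_num q
    push_cast
    field_simp
    rw [← h3] at h2
    linear_combination h2

lemma exists_sign_root (d : ℤ) (σ : GQ) :
    ∃ ε : ℤˣ, σ (root d) = ((ε : ℤ) : Qbar) * root d := by
  have h : σ (root d) ^ 2 = root d ^ 2 := by rw [← map_pow, root_sq, map_intCast]
  rcases sq_eq_sq_iff_eq_or_eq_neg.mp h with h | h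
  · exact ⟨1, by simpa using h⟩
  · exact ⟨-1, by simpa using h⟩

/-- A squarefree integer is determined by the character by which the Galois group acts on its
square root. -/
lemma eq_of_root_galois {d e : ℤ} (hd : Squarefree d) (he : Squarefree e)
    (h : ∀ σ : GQ, ∃ ε : ℤˣ, σ (root d) = ((ε : ℤ) : Qbar) * root d ∧
      σ (root e) = ((ε : ℤ) : Qbar) * root e) : d = e := by
  obtain ⟨r, hr⟩ : root d * root e ∈ Set.range (algebraMap ℚ Qbar) := by
    rw [InfiniteGalois.mem_range_algebraMap_iff_fixed]
    intro σ
    obtain ⟨ε, h1, h2⟩ := h σ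
    have hε : ((ε : ℤ) : Qbar) * ((ε : ℤ) : Qbar) = 1 := by
      rw [← Int.cast_mul, ← Units.val_mul, Int.units_mul_self]; simp
    rw [map_mul, h1, h2]
    linear_combination root d * root e * hε
  refine eq_of_squarefree_of_isSquare_mul hd he (Rat.isSquare_intCast_iff.mp ⟨r, ?_⟩)
  apply (algebraMap ℚ Qbar).injective
  rw [map_mul, hr, map_intCast, Int.cast_mul, ← root_sq d, ← root_sq e]
  ring

/-- Every quadratic character of the Galois group with open kernel is the character of `√d` for some
squarefree `d`. Any nonzero `α` on which the group acts through the character has a rational square,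
and `d` is the squarefree part of that square. -/
lemma exists_squarefree_of_isOpen_ker (χ : GQ →* ℤˣ) (hχ : IsOpen (χ.ker : Set GQ)) :
    ∃ d : ℤ, Squarefree d ∧ ∀ σ : GQ, σ (root d) = ((χ σ : ℤ) : Qbar) * root d := by
  obtain ⟨α, hα0, hα⟩ : ∃ α : Qbar, α ≠ 0 ∧ ∀ σ : GQ, σ α = ((χ σ : ℤ) : Qbar) * α := by
    by_cases htriv : ∀ σ, χ σ = 1
    · exact ⟨1, one_ne_zero, fun σ => by simp [htriv]⟩
    · push Not at htriv
      obtain ⟨τ, hτ⟩ := htriv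
      have hker := InfiniteGalois.fixingSubgroup_fixedField
        (⟨χ.ker, χ.ker.isClosed_of_isOpen hχ⟩ : ClosedSubgroup GQ)
      have hτ' : τ ∉ (IntermediateField.fixedField χ.ker).fixingSubgroup := by
        intro h
        exact hτ (MonoidHom.mem_ker.mp ((SetLike.ext_iff.mp hker τ).mp h))
      rw [IntermediateField.mem_fixingSubgroup_iff] at hτ'
      push Not at hτ'
      -- `x` generates the quadratic field fixed by the kernel, and `τ x` is its conjugate
      obtain ⟨x, hx, hxτ⟩ := hτ'
      have hfix : ∀ σ : GQ, χ σ = 1 → σ x = x := fun σ hσ => hx ⟨σ, hσ⟩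
      have hτ1 : χ τ = -1 := (Int.units_eq_one_or _).resolve_left hτ
      refine ⟨x - τ x, sub_ne_zero.mpr (Ne.symm hxτ), fun σ => ?_⟩
      have hswap : ∀ g h : GQ, χ g = χ h → g x = h x := by
        intro g h hgh
        have := hfix (h⁻¹ * g) (by rw [map_mul, map_inv, hgh, inv_mul_cancel])
        rw [AlgEquiv.mul_apply] at this
        rw [← this, ← AlgEquiv.mul_apply h, mul_inv_cancel, AlgEquiv.one_apply, this]
      rcases Int.units_eq_one_or (χ σ) with h | h
      · have h2 := hswap (σ * τ) τ (by rw [map_mul, h, one_mul])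
        rw [AlgEquiv.mul_apply] at h2
        simp [h, hfix σ h, h2]
      · have h1 := hswap σ τ (by rw [h, hτ1])
        have h2 := hfix (σ * τ) (by rw [map_mul, h, hτ1]; rfl)
        rw [AlgEquiv.mul_apply] at h2
        simp [h, h1, h2]
  obtain ⟨q, hq⟩ : α ^ 2 ∈ Set.range (algebraMap ℚ Qbar) := by
    rw [InfiniteGalois.mem_range_algebraMap_iff_fixed]
    intro σ
    rw [map_pow, hα]
    rcases Int.units_eq_one_or (χ σ) with h | h <;> simp [h]
  have hq0 : q ≠ 0 := by
    rintro rfl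
    exact pow_ne_zero 2 hα0 (by rw [← hq, map_zero])
  obtain ⟨d, hd, r, hr, rfl⟩ := exists_squarefree_mul_sq hq0
  refine ⟨d, hd, ?_⟩
  have hr' : (algebraMap ℚ Qbar r) ≠ 0 := by simpa using hr
  have : α ^ 2 = (algebraMap ℚ Qbar r * root d) ^ 2 := by
    rw [← hq, mul_pow, root_sq]; simp
  intro σ
  have hσ := hα σ
  rcases sq_eq_sq_iff_eq_or_eq_neg.mp this with h | h
  all_goals
    rw [h] at hσ
    simp only [map_neg, map_mul, AlgEquiv.commutes] at hσ
    apply mul_left_cancel₀ hr'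
  · linear_combination hσ
  · linear_combination -hσ

/-! ### Galois action and quadratic twists -/

/-- The Galois action on the geometric points as a group homomorphism. -/
noncomputable def galHom (E : WeierstrassCurve ℚ) : GQ →* AddMonoid.End (GeomPoint E) where
  toFun σ := gal E σ
  map_one' := by ext P; cases P <;> rfl
  map_mul' σ τ := by ext P; cases P <;> rfl

/-- A geometric point has finitely many coordinates, which are algebraic, so that its stabilizer
is open. -/
lemma exists_isOpen_subgroup_gal_eq (E : WeierstrassCurve ℚ) (P : GeomPoint E) :
    ∃ U : Subgroup GQ, IsOpen (U : Set GQ) ∧ ∀ σ ∈ U, gal E σ P = P := by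
  rcases P with _ | ⟨x, y, h⟩
  · exact ⟨⊤, isOpen_univ, fun _ _ => rfl⟩
  · refine ⟨MulAction.stabilizer GQ x ⊓ MulAction.stabilizer GQ y,
      (stabilizer_isOpen_of_isIntegral x).inter (stabilizer_isOpen_of_isIntegral y), ?_⟩
    rintro σ ⟨hx, hy⟩
    replace hx : σ x = x := hx
    replace hy : σ y = y := hy
    refine (WeierstrassCurve.Affine.Point.map_some (W' := E) (σ : Qbar →ₐ[ℚ] Qbar) h).trans ?_
    simp [hx, hy]

lemma twist_isElliptic (E : WeierstrassCurve ℚ) [hE : E.IsElliptic] {d : ℤ} (hd : d ≠ 0) :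
    (twist E d).IsElliptic := by
  have hΔ : (twist E d).Δ = d ^ 6 * E.Δ := by
    simp only [WeierstrassCurve.Δ, WeierstrassCurve.b₂, WeierstrassCurve.b₄, WeierstrassCurve.b₆,
      WeierstrassCurve.b₈, twist]
    ring
  refine ⟨?_⟩
  rw [hΔ]
  exact (IsUnit.mk0 _ (pow_ne_zero _ (by exact_mod_cast hd))).mul hE.isUnit

lemma twistIso_some (E : WeierstrassCurve ℚ) {d : ℤ} (hd : d ≠ 0) {x y : Qbar}
    (h : (WeierstrassCurve.Affine.baseChange E Qbar).Nonsingular x y) :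
    ∃ h', twistIso E hd (.some x y h) = .some (root d ^ 2 * x)
      (root d ^ 3 * (y + (algebraMap ℚ Qbar E.a₁ * x + algebraMap ℚ Qbar E.a₃) / 2)) h' :=
  ⟨_, rfl⟩

lemma twistIso_injective (E : WeierstrassCurve ℚ) {d : ℤ} (hd : d ≠ 0) :
    Function.Injective (twistIso E hd) := by
  rw [injective_iff_map_eq_zero]
  rintro (_ | ⟨x, y, h⟩) hP
  · rfl
  · obtain ⟨h', he⟩ := twistIso_some E hd h
    rw [he] at hP
    exact absurd hP (WeierstrassCurve.Affine.Point.some_ne_zero _)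

/-- The twisting isomorphism is Galois equivariant up to the sign by which the Galois group acts on
`√d`. -/
lemma gal_twistIso (E : WeierstrassCurve ℚ) {d : ℤ} (hd : d ≠ 0) {σ : GQ} {ε : ℤˣ}
    (hσ : σ (root d) = ((ε : ℤ) : Qbar) * root d) (P : GeomPoint E) :
    gal (twist E d) σ (twistIso E hd P) = (ε : ℤ) • twistIso E hd (gal E σ P) := by
  rcases P with _ | ⟨x, y, h⟩
  · change gal (twist E d) σ (twistIso E hd 0) = (ε : ℤ) • twistIso E hd (gal E σ 0)
    rw [map_zero, map_zero, map_zero, map_zero]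
    exact (zsmul_zero _).symm
  · obtain ⟨h₁, e₁⟩ := twistIso_some E hd h
    have e₂ : gal E σ (.some x y h) = .some (σ x) (σ y) _ :=
      WeierstrassCurve.Affine.Point.map_some (W' := E) (σ : Qbar →ₐ[ℚ] Qbar) h
    obtain ⟨h₃, e₃⟩ := twistIso_some E hd
      ((WeierstrassCurve.Affine.baseChange_nonsingular E (σ : Qbar →ₐ[ℚ] Qbar).injective ..).mpr h)
    have h2 : σ 2 = 2 := map_ofNat σ 2
    rw [e₁, e₂]
    refine (WeierstrassCurve.Affine.Point.map_some (W' := twist E d)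
      (σ : Qbar →ₐ[ℚ] Qbar) h₁).trans ?_
    erw [e₃]
    rcases Int.units_eq_one_or ε with rfl | rfl
    · simp only [Units.val_one, one_smul, Int.cast_one, one_mul] at hσ ⊢
      simp [hσ, h2]
    · simp only [Units.val_neg, Units.val_one, Int.cast_neg, Int.cast_one, neg_mul, one_mul,
        neg_smul, one_smul] at hσ ⊢
      rw [WeierstrassCurve.Affine.Point.neg_some, WeierstrassCurve.Affine.Point.some.injEq]
      simp [hσ, h2, WeierstrassCurve.Affine.negY, twist]
      ring

/-! ### Rational points of the half modular curve -/

lemma neg_mem_YHalf {N : ℕ} {H : Subgroup (ZMod N)ˣ} {E : WeierstrassCurve ℚ}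
    {S : Set (GeomPoint E)}
    (h : (⟨E, S⟩ : Σ E : WeierstrassCurve ℚ, Set (GeomPoint E)) ∈ YHalf N H) :
    (⟨E, -S⟩ : Σ E : WeierstrassCurve ℚ, Set (GeomPoint E)) ∈ YHalf N H := by
  obtain ⟨hE, ⟨P, hP, hS⟩, hdef⟩ := h
  replace hS : S = orbit H P := hS
  refine ⟨hE, ⟨-P, by rw [addOrderOf_neg, hP], by rw [← neg_orbit, hS]⟩, fun σ Q hQ => ?_⟩
  have := hdef σ (-Q) hQ
  rwa [map_neg] at this

lemma nsmul_eq_zero_of_mem_zmultiples {A : Type*} [AddCommGroup A] {N : ℕ} {P Q : A}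
    (hP : addOrderOf P = N) (hQ : Q ∈ AddSubgroup.zmultiples P) : N • Q = 0 := by
  obtain ⟨k, rfl⟩ := hQ
  simp only
  rw [smul_comm, ← hP, addOrderOf_nsmul_eq_zero, smul_zero]

lemma twistSubgroup_zmultiples (E : WeierstrassCurve ℚ) {d : ℤ} (hd : d ≠ 0) (P : GeomPoint E) :
    twistSubgroup E hd (AddSubgroup.zmultiples P) = AddSubgroup.zmultiples (twistIso E hd P) :=
  AddMonoidHom.map_zmultiples _ _

/-- If the Galois group acts on `⟨P⟩` through `χ` and on `√d` through `ψ`, then it acts on the image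
of `⟨P⟩` in the twist by `d` through `ψ χ`. -/
lemma gal_twistSubgroup {N : ℕ} [NeZero N] {E : WeierstrassCurve ℚ} {P : GeomPoint E}
    (hP : addOrderOf P = N) {σ : GQ} {a : (ZMod N)ˣ}
    (ha : ∀ Q ∈ AddSubgroup.zmultiples P, gal E σ Q = unitMul a Q) {d : ℤ} (hd : d ≠ 0) {ε : ℤˣ}
    (hε : σ (root d) = ((ε : ℤ) : Qbar) * root d) {Q : GeomPoint (twist E d)}
    (hQ : Q ∈ twistSubgroup E hd (AddSubgroup.zmultiples P)) :
    gal (twist E d) σ Q = unitMul (signToUnits N ε * a) Q := by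
  obtain ⟨Q, hQ, rfl⟩ := hQ
  have hNQ : N • twistIso E hd Q = 0 := by
    rw [← map_nsmul, nsmul_eq_zero_of_mem_zmultiples hP hQ, map_zero]
  rw [gal_twistIso E hd hε, ha Q hQ, map_unitMul, unitMul_mul hNQ, unitMul_signToUnits]
  rw [unitMul, smul_comm, hNQ]
  exact nsmul_zero _

/-- If `χ` is the character of the Galois action on `⟨P⟩` and `ψ` that on `√d`, then a Galois stable
`H`-orbit of generators in the twist by `d` forces `ψ χ` to take values in `H`. For an admissible
`H` this leaves one choice for `ψ`, hence for `d`. -/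
lemma sign_mul_mem_of_isDefinedOverQ {N : ℕ} [NeZero N] {H : Subgroup (ZMod N)ˣ}
    {E : WeierstrassCurve ℚ} {P : GeomPoint E} (hP : addOrderOf P = N) {χ : GQ →* (ZMod N)ˣ}
    (hχ : ∀ σ, ∀ Q ∈ AddSubgroup.zmultiples P, gal E σ Q = unitMul (χ σ) Q) {d : ℤ} (hd : d ≠ 0)
    {S : Set (GeomPoint (twist E d))}
    (hS : IsHalfOfGenerators H (twistSubgroup E hd (AddSubgroup.zmultiples P)) S)
    (hSQ : IsDefinedOverQ (twist E d) S) {σ : GQ} {ε : ℤˣ}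
    (hε : σ (root d) = ((ε : ℤ) : Qbar) * root d) : signToUnits N ε * χ σ ∈ H := by
  obtain ⟨R, hR, rfl⟩ := hS
  have hRN : addOrderOf R = N := by
    rw [← Nat.card_zmultiples, hR, twistSubgroup_zmultiples, Nat.card_zmultiples,
      addOrderOf_injective _ (twistIso_injective E hd), hP]
  have hRR : R ∈ orbit H R := ⟨1, H.one_mem, by
    rw [unitMul_eq_zsmul (k := 1) (hRN ▸ addOrderOf_nsmul_eq_zero R) (by simp), one_smul]⟩
  obtain ⟨h, hh, he⟩ := hSQ σ R hRR
  rw [gal_twistSubgroup hP (hχ σ) hd hε (hR ▸ AddSubgroup.mem_zmultiples R)] at he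
  exact unitMul_injective hRN he ▸ hh

end HalfModular

theorem mainTheorem4 (N : ℕ) (hN : N ∈ ({3, 4, 6, 7, 8, 9, 12, 16, 18} : Finset ℕ)) :
    (∃ H : Subgroup (ZMod N)ˣ, HalfModular.IsAdmissible H) ∧
    ∀ H : Subgroup (ZMod N)ˣ, HalfModular.IsAdmissible H →
      IsCyclic H ∧
      ∀ (E : WeierstrassCurve ℚ) (C : AddSubgroup (HalfModular.GeomPoint E)),
        ⟨E, C⟩ ∈ HalfModular.YZero N →
        ∃ (d : ℤ) (hd : Squarefree d),
          -- the Galois action on the twisted subgroup is through `χ₂`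
          (⟨HalfModular.twist E d, HalfModular.twistSubgroup E hd.ne_zero C⟩ ∈
              HalfModular.YZero N ∧
            ∃ (χ : HalfModular.GQ →* (ZMod N)ˣ) (χ₁ : HalfModular.GQ →* ℤˣ)
              (χ₂ : HalfModular.GQ →* H),
              (∀ σ : HalfModular.GQ, ∀ P ∈ C,
                HalfModular.gal E σ P = HalfModular.unitMul (χ σ) P) ∧
              (∀ σ : HalfModular.GQ, χ σ = HalfModular.signToUnits N (χ₁ σ) * (χ₂ σ : (ZMod N)ˣ)) ∧
              (∀ σ : HalfModular.GQ,
                σ (HalfModular.root d) = ((χ₁ σ : ℤ) : HalfModular.Qbar) * HalfModular.root d) ∧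
              (∀ σ : HalfModular.GQ, ∀ Q ∈ HalfModular.twistSubgroup E hd.ne_zero C,
                HalfModular.gal (HalfModular.twist E d) σ Q =
                  HalfModular.unitMul (χ₂ σ : (ZMod N)ˣ) Q)) ∧
          -- the rational half of the generators, and the two rational points
          (∃ S : Set (HalfModular.GeomPoint (HalfModular.twist E d)),
            HalfModular.IsHalfOfGenerators H (HalfModular.twistSubgroup E hd.ne_zero C) S ∧
            HalfModular.IsDefinedOverQ (HalfModular.twist E d) S ∧
            ⟨HalfModular.twist E d, S⟩ ∈ HalfModular.YHalf N H ∧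
            ⟨HalfModular.twist E d, -S⟩ ∈ HalfModular.YHalf N H) ∧
          -- uniqueness of `d`
          ∀ (d' : ℤ) (hd' : Squarefree d'),
            (∃ S : Set (HalfModular.GeomPoint (HalfModular.twist E d')),
              HalfModular.IsHalfOfGenerators H (HalfModular.twistSubgroup E hd'.ne_zero C) S ∧
              HalfModular.IsDefinedOverQ (HalfModular.twist E d') S) →
            d' = d := by

  open HalfModular in
  obtain ⟨u, hu, huv⟩ := exists_isCompl_neg_one hN
  have : NeZero N := ⟨by rintro rfl; simp at hN⟩
  refine ⟨⟨Subgroup.zpowers u, isAdmissible_iff.mpr ⟨hu, huv⟩⟩, fun H hH =>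
    ⟨hH.isCyclic huv, ?_⟩⟩
  rintro E C ⟨hE, hcyc, hcard, hCQ⟩
  replace hE : E.IsElliptic := hE
  obtain ⟨P, rfl⟩ := (AddSubgroup.isAddCyclic_iff_exists_zmultiples_eq_top C).mp hcyc
  have hP : addOrderOf P = N := by rw [← Nat.card_zmultiples]; exact hcard
  have hNP : N • P = 0 := hP ▸ addOrderOf_nsmul_eq_zero P
  obtain ⟨χ, hχ⟩ := exists_character (galHom E) hP
    fun σ => hCQ σ P (AddSubgroup.mem_zmultiples P)
  replace hχ : ∀ σ, ∀ Q ∈ AddSubgroup.zmultiples P, gal E σ Q = unitMul (χ σ) Q := hχ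
  obtain ⟨s, hs⟩ := hH.exists_sign
  -- the sign of `χ` is trivial on the open stabilizer of `P`
  obtain ⟨d, hd, hroot⟩ := exists_squarefree_of_isOpen_ker (s.comp χ) (by
    obtain ⟨U, hU, hUP⟩ := exists_isOpen_subgroup_gal_eq E P
    refine Subgroup.isOpen_mono (fun σ hσ => ?_) hU
    have h1 : χ σ = 1 := unitMul_injective hP (by
      rw [← hχ σ P (AddSubgroup.mem_zmultiples P), hUP σ hσ,
        unitMul_eq_zsmul hNP (k := 1) (by simp), one_smul])
    simp [MonoidHom.mem_ker, h1])
  have hact : ∀ σ, ∀ Q ∈ twistSubgroup E hd.ne_zero (AddSubgroup.zmultiples P),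
      gal (twist E d) σ Q = unitMul (signToUnits N (s (χ σ)) * χ σ) Q :=
    fun σ Q hQ => gal_twistSubgroup hP (hχ σ) hd.ne_zero (hroot σ) hQ
  have hell := twist_isElliptic E hd.ne_zero
  have hgen := twistSubgroup_zmultiples E hd.ne_zero P
  have hord : addOrderOf (twistIso E hd.ne_zero P) = N := by
    rw [addOrderOf_injective _ (twistIso_injective E hd.ne_zero), hP]
  have hSQ : IsDefinedOverQ (twist E d) (orbit H (twistIso E hd.ne_zero P)) := by
    rintro σ _ ⟨h, hh, rfl⟩
    have hmem : twistIso E hd.ne_zero P ∈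
        twistSubgroup E hd.ne_zero (AddSubgroup.zmultiples P) :=
      hgen ▸ AddSubgroup.mem_zmultiples _
    refine ⟨_, H.mul_mem hh (hs (χ σ)), ?_⟩
    rw [map_unitMul, hact σ _ hmem, unitMul_mul (N := N) (hord ▸ addOrderOf_nsmul_eq_zero _) h]
  have hhalf : (⟨twist E d, orbit H (twistIso E hd.ne_zero P)⟩ :
      Σ E : WeierstrassCurve ℚ, Set (GeomPoint E)) ∈ YHalf N H :=
    ⟨hell, ⟨_, hord, rfl⟩, hSQ⟩
  refine ⟨d, hd, ⟨⟨hell, ?_, ?_, ?_⟩, χ, s.comp χ,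
    (((signToUnits N).comp (s.comp χ)) * χ).codRestrict H fun σ => hs (χ σ),
    hχ, fun σ => ?_, hroot, hact⟩, ⟨_, ⟨_, hgen.symm, rfl⟩, hSQ, hhalf, neg_mem_YHalf hhalf⟩, ?_⟩
  · change IsAddCyclic (twistSubgroup E hd.ne_zero (AddSubgroup.zmultiples P))
    rw [hgen]
    infer_instance
  · change Nat.card (twistSubgroup E hd.ne_zero (AddSubgroup.zmultiples P)) = N
    rw [hgen, Nat.card_zmultiples, hord]
  · intro σ Q hQ
    rw [hact σ Q hQ]
    exact AddSubgroup.nsmul_mem _ hQ _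
  · change χ σ = signToUnits N (s (χ σ)) * (signToUnits N (s (χ σ)) * χ σ)
    rw [← mul_assoc, signToUnits_mul_self, one_mul]
  · rintro d' hd' ⟨S, hS, hSQ'⟩
    refine eq_of_root_galois hd' hd fun σ => ?_
    obtain ⟨ε, hε⟩ := exists_sign_root d' σ
    have h1 := sign_mul_mem_of_isDefinedOverQ hP hχ hd'.ne_zero hS hSQ' hε
    have h2 := hH.sign_unique h1 (hs (χ σ))
    exact ⟨ε, hε, h2 ▸ hroot σ⟩
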